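/- Let $\mathrm{Gr}_{m,n}=\{P\in\mathbb C^{n\times n} : P^{H}=P,\ P^2=P,\ \operatorname{tr}P=m\}$ be the complex Grassmannian, viewed as a submanifold of the Hermitian matrices and endowed with the Riemannian metric $g_P(H_1,H_2)=\operatorname{tr}(H_1H_2)$ on the tangent spaces $T_P\mathrm{Gr}_{m,n}$. Let $\operatorname{dist}$ be the associated Riemannian (geodesic) distance, and write $\operatorname{ad}_A X=[A,X]=AX-XA$. For $Q\in\mathrm{Gr}_{m,n}$ and $\xi\in T_Q\mathrm{Gr}_{m,n}$ let $\exp_Q(\xi)=e^{[\xi,Q]}\,Q\,e^{-[\xi,Q]}$ be the Riemannian exponential map. Fix $Q\in\mathrm{Gr}_{m,n}$. There are a radius $r>0$ and an open neighbourhood $V$ of $Q$ in $\mathrm{Gr}_{m,n}$ such that $\exp_Q$ is a bijection from the ball $B=\{\xi\in T_Q\mathrm{Gr}_{m,n}:\operatorname{tr}\xi^2<r^2\}$ onto $V$, and such that the function $f(P)=\operatorname{dist}^2(P,Q)$ has the following properties. 1. For every $P\in V$, written as $P=e^{[\xi,Q]}Qe^{-[\xi,Q]}$ with the unique such $\xi\in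 B$, one has $f(P)=\operatorname{tr}\xi^2$; the function $f$ is smooth at $P$, and its Riemannian gradient there is $$\operatorname{grad}f(P)=2\operatorname{ad}_{[\xi,Q]}P=2\,[[\xi,Q],P].$$ That is, $2[[\xi,Q],P]\in T_P\mathrm{Gr}_{m,n}$, and $\mathrm Df(P)H=\operatorname{tr}\big(2[[\xi,Q],P]\,H\big)$ for all $H\in T_P\mathrm{Gr}_{m,n}$. 2. The only critical point of $f$ in $V$ is $Q$: for $P\in V$, $\mathrm Df(P)=0$ if and only if $P=Q$. -/

import Mathlib

/- The norm on matrices opened here only serves to speak of derivatives; all norms on this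
finite-dimensional space give the same derivatives, and the metric below does not use it. -/
open scoped Matrix ContDiff Matrix.Norms.L2Operator

noncomputable section

namespace Grass

/-- The complex Grassmannian, as the set of Hermitian projections of `ℂⁿ` of rank (= trace) `m`. -/
def Gr (m n : ℕ) : Set (Matrix (Fin n) (Fin n) ℂ) :=
  {P | Pᴴ = P ∧ P * P = P ∧ P.trace = (m : ℂ)}

/-- The tangent space at `P`: velocities at time `0` of smooth curves in the Grassmannian that
pass through `P` at time `0`. -/
def tangentSpace (m : ℕ) {n : ℕ} (P : Matrix (Fin n) (Fin n) ℂ) :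
    Set (Matrix (Fin n) (Fin n) ℂ) :=
  {H | ∃ α : ℝ → Matrix (Fin n) (Fin n) ℂ,
    ContDiff ℝ ∞ α ∧ (∀ t, α t ∈ Gr m n) ∧ α 0 = P ∧ deriv α 0 = H}

/-- The metric `g(H₁, H₂) = tr (H₁ H₂)`. The trace of a product of two Hermitian matrices is
real; taking the real part only changes the codomain. -/
def metric {n : ℕ} (H₁ H₂ : Matrix (Fin n) (Fin n) ℂ) : ℝ :=
  (H₁ * H₂).trace.re

/-- `ad_A X = [A, X] = A X - X A`. -/
def ad {n : ℕ} (A X : Matrix (Fin n) (Fin n) ℂ) : Matrix (Fin n) (Fin n) ℂ :=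
  A * X - X * A

/-- The Riemannian exponential map `exp_Q(ξ) = e^{[ξ,Q]} Q e^{-[ξ,Q]}`. -/
def riemExp {n : ℕ} (Q ξ : Matrix (Fin n) (Fin n) ℂ) : Matrix (Fin n) (Fin n) ℂ :=
  NormedSpace.exp (ad ξ Q) * Q * NormedSpace.exp (-(ad ξ Q))

/-- The length of the curve `γ` over the time interval `[0, 1]`. -/
def curveLength {n : ℕ} (γ : ℝ → Matrix (Fin n) (Fin n) ℂ) : ℝ :=
  ∫ t in (0 : ℝ)..1, Real.sqrt (metric (deriv γ t) (deriv γ t))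

/-- The Riemannian (geodesic) distance: the infimum of the lengths of the `C¹` curves in the
Grassmannian that join `P` to `Q` over the time interval `[0, 1]`. As the Grassmannian is
connected, the set of lengths is nonempty for `P, Q` in `Gr m n`. -/
def dist (m : ℕ) {n : ℕ} (P Q : Matrix (Fin n) (Fin n) ℂ) : ℝ :=
  sInf {L | ∃ γ : ℝ → Matrix (Fin n) (Fin n) ℂ,
    ContDiff ℝ 1 γ ∧ (∀ t ∈ Set.Icc (0 : ℝ) 1, γ t ∈ Gr m n) ∧
    γ 0 = P ∧ γ 1 = Q ∧ L = curveLength γ}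

/-- A real function on the Grassmannian is smooth at `P` if near `P` it is the restriction of a
function on the ambient space that is smooth at `P`. Only the values of `f` on `Gr m n` matter. -/
def SmoothAt (m : ℕ) {n : ℕ} (f : Matrix (Fin n) (Fin n) ℂ → ℝ)
    (P : Matrix (Fin n) (Fin n) ℂ) : Prop :=
  ∃ F : Matrix (Fin n) (Fin n) ℂ → ℝ,
    ContDiffAt ℝ ∞ F P ∧ ∀ᶠ X in nhdsWithin P (Gr m n), F X = f X

/-- `D f(P) H = d`: the function `f` has derivative `d` at time `0` along every curve in the
Grassmannian that passes through `P` at time `0` with velocity `H`. -/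
def HasDirDeriv (m : ℕ) {n : ℕ} (f : Matrix (Fin n) (Fin n) ℂ → ℝ)
    (P H : Matrix (Fin n) (Fin n) ℂ) (d : ℝ) : Prop :=
  ∀ γ : ℝ → Matrix (Fin n) (Fin n) ℂ, (∀ t, γ t ∈ Gr m n) → γ 0 = P → HasDerivAt γ H 0 →
    HasDerivAt (fun t => f (γ t)) d 0

/-- `G` is the Riemannian gradient at `P` of `f`: the function `f` is smooth at `P`, the matrix
`G` is a tangent vector at `P`, and `D f(P) H = g(G, H)` for all tangent vectors `H` at `P`. -/
def IsRiemGrad (m : ℕ) {n : ℕ} (f : Matrix (Fin n) (Fin n) ℂ → ℝ)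
    (P G : Matrix (Fin n) (Fin n) ℂ) : Prop :=
  SmoothAt m f P ∧ G ∈ tangentSpace m P ∧
    ∀ H ∈ tangentSpace m P, HasDirDeriv m f P H (metric G H)

/-- `P` is a critical point of `f`: `D f(P) H = 0` for all tangent vectors `H` at `P`. -/
def IsCriticalPt (m : ℕ) {n : ℕ} (f : Matrix (Fin n) (Fin n) ℂ → ℝ)
    (P : Matrix (Fin n) (Fin n) ℂ) : Prop :=
  ∀ H ∈ tangentSpace m P, HasDirDeriv m f P H 0

/-- The open ball of radius `r` around `0` in the tangent space at `Q`. -/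
def tangentBall (m : ℕ) {n : ℕ} (Q : Matrix (Fin n) (Fin n) ℂ) (r : ℝ) :
    Set (Matrix (Fin n) (Fin n) ℂ) :=
  {ξ | ξ ∈ tangentSpace m Q ∧ metric ξ ξ < r ^ 2}

end Grass

end

noncomputable section
namespace Grass

/-! Send a projection `P` to the unitary matrix `refl P * refl Q`. For `Ω = [ξ,Q]`, skew-Hermitian
and anticommuting with `refl Q`, the point `riemExp Q ξ` goes to `exp (2Ω)`, and Frobenius speeds
double. Distances to `Q` thus reduce to lengths of unitary curves ending at `1`.

The curve `e^{tΩ} Q e^{-tΩ}` bounds the distance above by `√(tr ξ²)`. For the lower bound,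
diagonalize `2Ω`: each column of a unitary curve moves on a unit sphere, its angle to the basis
vector changes no faster than the column moves, and Cauchy–Schwarz combines the columns
(`sqrt_trace_le_length`, `sqrt_metric_le_curveLength`).

The inverse function theorem gives a logarithm near `1`. Its uniqueness transfers the symmetries of
`refl P * refl Q` to the logarithm, so `exp_Q` is bijective (`IsLogChart.bijOn_riemExp`). Near `Q`
the squared distance is then `-1/4 tr log²`, differentiated by means of
`trace_exp_neg_mul_fderiv_exp`. If the gradient vanishes, `Ω` commutes with `P`; conjugating `P`
back by `e^{-Ω}` then gives both `P` and `Q`. -/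

/-- Square complex matrices. -/
abbrev Mat (n : ℕ) := Matrix (Fin n) (Fin n) ℂ

/-- The algebraic description of tangent vectors at a projection `P`. -/
def IsTangent {n : ℕ} (P H : Mat n) : Prop :=
  Hᴴ = H ∧ H * P + P * H = H

/-- The reflection `1 - 2 P`. -/
def refl {n : ℕ} (P : Mat n) : Mat n := 1 - (2 : ℝ) • P

/-! ### Algebra of projections, tangent vectors and reflections -/

section Ring

variable {A : Type*} [Ring A] {p h : A}

theorem mul_mul_eq_zero_of_tangent (hp : p * p = p) (hh : h * p + p * h = h) : p * h * p = 0 := by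
  have := congrArg (p * ·) hh
  simp only [mul_add, ← mul_assoc, hp] at this
  simpa using this

end Ring

variable {m n : ℕ} {P Q X Y ξ Ω H : Mat n}

/-- A tangent vector is off-diagonal for the splitting into range and kernel of `Q`, so the terms
`QξQ` of the double bracket vanish. Hence the generator `[ξ,Q]` determines `ξ`. -/
theorem ad_ad_of_isTangent (hQ : Q * Q = Q) (hξ : IsTangent Q ξ) : ad (ad ξ Q) Q = ξ := by
  have h0 := mul_mul_eq_zero_of_tangent hQ hξ.2
  have h1 : ad (ad ξ Q) Q = ξ * (Q * Q) + (Q * Q) * ξ - Q * ξ * Q - Q * ξ * Q := by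
    unfold ad; noncomm_ring
  rw [h1, h0, hQ, sub_zero, sub_zero, hξ.2]

theorem conjTranspose_ad_of_isTangent (hQ : Qᴴ = Q) (hξ : IsTangent Q ξ) :
    (ad ξ Q)ᴴ = -ad ξ Q := by
  simp [ad, hξ.1, hQ]

theorem refl_mul_refl (hQ : Q * Q = Q) : refl Q * refl Q = 1 := by
  simp only [refl, sub_mul, mul_sub, one_mul, mul_one, smul_mul_assoc, mul_smul_comm, hQ]
  module

theorem conjTranspose_refl (hQ : Qᴴ = Q) : (refl Q)ᴴ = refl Q := by
  simp [refl, hQ]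

/-- The reflection is `-1` and `+1` on the two blocks, and `[ξ,Q]` is off-diagonal. -/
theorem refl_mul_ad (hQ : Q * Q = Q) (hξ : IsTangent Q ξ) :
    refl Q * ad ξ Q = -(ad ξ Q * refl Q) := by
  have h0 := mul_mul_eq_zero_of_tangent hQ hξ.2
  have h1 : ad ξ Q * Q = ξ * Q := by
    rw [ad, sub_mul, h0, mul_assoc, hQ, sub_zero]
  have h2 : Q * ad ξ Q = -(Q * ξ) := by
    rw [ad, mul_sub, ← mul_assoc, h0, ← mul_assoc, hQ, zero_sub]
  simp only [refl, sub_mul, mul_sub, one_mul, mul_one, smul_mul_assoc, mul_smul_comm, h1, h2]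
  simp only [ad]
  module

theorem ad_mul_add_mul_ad (hP : P * P = P) : ad Ω P * P + P * ad Ω P = ad Ω P := by
  have h1 : ad Ω P * P + P * ad Ω P = Ω * (P * P) - (P * P) * Ω := by unfold ad; noncomm_ring
  rw [h1, hP, ad]

theorem isTangent_ad (hP : Pᴴ = P) (hP' : P * P = P) (hΩ : Ωᴴ = -Ω) : IsTangent P (ad Ω P) := by
  refine ⟨?_, ad_mul_add_mul_ad hP'⟩
  simp only [ad, Matrix.conjTranspose_sub, Matrix.conjTranspose_mul, hP, hΩ]
  noncomm_ring

/-- A matrix that anticommutes with the reflection is recovered from its bracket. -/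
theorem ad_ad_of_refl_mul (hQ : Q * Q = Q) (hΩ : refl Q * Ω = -(Ω * refl Q)) :
    ad (ad Ω Q) Q = Ω := by
  have h1 : Q * Ω + Ω * Q = Ω := by
    have h2 : (2 : ℝ) • (Q * Ω + Ω * Q) = (2 : ℝ) • Ω := by
      simp only [refl, sub_mul, mul_sub, one_mul, mul_one, smul_mul_assoc, mul_smul_comm] at hΩ
      have : (2 : ℝ) • (Q * Ω + Ω * Q) =
        (2 : ℝ) • Ω - ((Ω - (2 : ℝ) • (Q * Ω)) - (-(Ω - (2 : ℝ) • (Ω * Q)))) := by module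
      rw [this, hΩ, sub_self, sub_zero]
    exact smul_right_injective _ (two_ne_zero : (2 : ℝ) ≠ 0) h2
  have h0 := mul_mul_eq_zero_of_tangent hQ ((add_comm _ _).trans h1)
  have h3 : ad (ad Ω Q) Q = Ω * (Q * Q) + (Q * Q) * Ω - Q * Ω * Q - Q * Ω * Q := by
    unfold ad; noncomm_ring
  rw [h3, h0, hQ, sub_zero, sub_zero, add_comm, h1]

/-- Writing one factor `ξ` as a double bracket, the two sides differ by the trace of a commutator.
-/
theorem trace_mul_self_of_isTangent (hQ : Q * Q = Q) (hξ : IsTangent Q ξ) :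
    (ξ * ξ).trace = -(ad ξ Q * ad ξ Q).trace := by
  have h1 : (ad ξ Q * ξ * Q).trace - (Q * (ad ξ Q * ξ)).trace = 0 := by
    rw [Matrix.trace_mul_comm, sub_self]
  have h2 : ξ * ξ = ad (ad ξ Q) Q * ξ := by rw [ad_ad_of_isTangent hQ hξ]
  have h3 : ad (ad ξ Q) Q * ξ = -(ad ξ Q * ad ξ Q) + (ad ξ Q * ξ * Q - Q * (ad ξ Q * ξ)) := by
    unfold ad; noncomm_ring
  rw [h2, h3, Matrix.trace_add, Matrix.trace_neg, Matrix.trace_sub, h1, add_zero]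

theorem eq_of_refl_eq (h : refl P = refl Q) : P = Q :=
  smul_right_injective _ (two_ne_zero : (2 : ℝ) ≠ 0) (sub_right_injective h)

/-! ### The exponential -/

theorem contDiff_exp : ContDiff ℝ ω (NormedSpace.exp : Mat n → Mat n) :=
  contDiff_iff_contDiffAt.2 fun x => (NormedSpace.exp_analytic (𝕂 := ℝ) x).contDiffAt

theorem exp_mul_exp_neg (X : Mat n) : NormedSpace.exp X * NormedSpace.exp (-X) = 1 := by
  rw [← Matrix.exp_add_of_commute _ _ (Commute.neg_right (Commute.refl X)), add_neg_cancel,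
    NormedSpace.exp_zero]

theorem exp_neg_mul_exp (X : Mat n) : NormedSpace.exp (-X) * NormedSpace.exp X = 1 := by
  simpa using exp_mul_exp_neg (-X)

theorem exp_two_smul (X : Mat n) :
    NormedSpace.exp ((2 : ℝ) • X) = NormedSpace.exp X * NormedSpace.exp X := by
  rw [two_smul, Matrix.exp_add_of_commute _ _ (Commute.refl X)]

theorem exp_conj_of_mul_self (hR : X * X = 1) (Y : Mat n) :
    NormedSpace.exp (X * Y * X) = X * NormedSpace.exp Y * X :=
  Matrix.exp_units_conj ⟨X, X, hR, hR⟩ Y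

theorem exp_conjTranspose (X : Mat n) : NormedSpace.exp Xᴴ = (NormedSpace.exp X)ᴴ :=
  Matrix.exp_conjTranspose X

/-- Conjugation of `Q` by `e^Ω`. -/
def conjExp (Ω Q : Mat n) : Mat n := NormedSpace.exp Ω * Q * NormedSpace.exp (-Ω)

theorem conjExp_mem (hQ : Q ∈ Gr m n) (hΩ : Ωᴴ = -Ω) : conjExp Ω Q ∈ Gr m n := by
  obtain ⟨h1, h2, h3⟩ := hQ
  refine ⟨?_, ?_, ?_⟩
  · rw [conjExp, Matrix.conjTranspose_mul, Matrix.conjTranspose_mul, ← exp_conjTranspose,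
      ← exp_conjTranspose, Matrix.conjTranspose_neg, hΩ, neg_neg, h1, mul_assoc]
  · calc conjExp Ω Q * conjExp Ω Q
        = NormedSpace.exp Ω * Q * (NormedSpace.exp (-Ω) * NormedSpace.exp Ω) * Q *
          NormedSpace.exp (-Ω) := by simp only [conjExp, mul_assoc]
      _ = NormedSpace.exp Ω * (Q * Q) * NormedSpace.exp (-Ω) := by
        rw [exp_neg_mul_exp, mul_one, mul_assoc _ Q Q]
      _ = conjExp Ω Q := by rw [h2, conjExp]
  · rw [conjExp, Matrix.trace_mul_comm, ← mul_assoc, exp_neg_mul_exp, one_mul, h3]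

theorem exp_mul_refl (hQ : Q * Q = Q) (hΩ : refl Q * Ω = -(Ω * refl Q)) :
    refl Q * NormedSpace.exp (-Ω) = NormedSpace.exp Ω * refl Q := by
  have h1 : refl Q * (-Ω) * refl Q = Ω := by
    rw [mul_neg, hΩ, neg_neg, mul_assoc, refl_mul_refl hQ, mul_one]
  have h2 := exp_conj_of_mul_self (refl_mul_refl hQ) (-Ω)
  rw [h1] at h2
  rw [h2, mul_assoc _ (refl Q) (refl Q), refl_mul_refl hQ, mul_one]

/-- Moving `e^{-Ω}` leftwards across the reflection turns it into `e^Ω`, whence the factor 2. -/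
theorem refl_conjExp (hQ : Q * Q = Q) (hΩ : refl Q * Ω = -(Ω * refl Q)) :
    refl (conjExp Ω Q) = NormedSpace.exp ((2 : ℝ) • Ω) * refl Q := by
  have h1 : refl (conjExp Ω Q) = NormedSpace.exp Ω * refl Q * NormedSpace.exp (-Ω) := by
    simp only [refl, conjExp, mul_sub, sub_mul, mul_one, exp_mul_exp_neg, mul_smul_comm,
      smul_mul_assoc]
  rw [h1, mul_assoc, exp_mul_refl hQ hΩ, ← mul_assoc, exp_two_smul]

theorem refl_mul_refl_conjExp (hQ : Q * Q = Q) (hΩ : refl Q * Ω = -(Ω * refl Q)) :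
    refl (conjExp Ω Q) * refl Q = NormedSpace.exp ((2 : ℝ) • Ω) := by
  rw [refl_conjExp hQ hΩ, mul_assoc, refl_mul_refl hQ, mul_one]

/-! ### Tangent spaces -/

theorem hasDerivAt_conjExp (Ω Q : Mat n) (t : ℝ) :
    HasDerivAt (fun s : ℝ => conjExp (s • Ω) Q) (conjExp (t • Ω) (ad Ω Q)) t := by
  have h1 := hasDerivAt_exp_smul_const Ω t
  have h2 := hasDerivAt_exp_smul_const' (-Ω) t
  have h3 := (h1.mul_const Q).mul h2
  have h4 : (fun s : ℝ => conjExp (s • Ω) Q) = fun s : ℝ =>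
      (NormedSpace.exp (s • Ω) * Q) * NormedSpace.exp (s • -Ω) := by
    funext s; simp [conjExp]
  rw [h4]
  refine h3.congr_deriv ?_
  simp only [conjExp, ad, smul_neg]; noncomm_ring

theorem contDiff_conjExp (Ω Q : Mat n) : ContDiff ℝ ω (fun s : ℝ => conjExp (s • Ω) Q) := by
  unfold conjExp
  have h1 : ContDiff ℝ ω (fun s : ℝ => s • Ω) := contDiff_id.smul contDiff_const
  exact ((contDiff_exp.comp h1).mul contDiff_const).mul (contDiff_exp.comp h1.neg)

theorem smul_skew (hΩ : Ωᴴ = -Ω) (t : ℝ) : (t • Ω)ᴴ = -(t • Ω) := by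
  rw [Matrix.conjTranspose_smul, hΩ, smul_neg, star_trivial]

theorem isTangent_of_hasDerivAt {γ : ℝ → Mat n} {t : ℝ}
    (hγ : ∀ᶠ s in nhds t, γ s ∈ Gr m n) (h : HasDerivAt γ H t) : IsTangent (γ t) H := by
  constructor
  · have h1 : HasDerivAt (fun s => (γ s)ᴴ) Hᴴ t := h.star
    exact h1.unique (h.congr_of_eventuallyEq (hγ.mono fun s hs => hs.1))
  · exact (h.mul h).unique (h.congr_of_eventuallyEq (hγ.mono fun s hs => hs.2.1))

/-- One direction differentiates `Pᴴ = P` and `P² = P`; for the other, conjugation by `e^{s[H,P]}`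
gives a curve with velocity `[[H,P],P] = H`. -/
theorem mem_tangentSpace_iff (hP : P ∈ Gr m n) : H ∈ tangentSpace m P ↔ IsTangent P H := by
  constructor
  · rintro ⟨α, h1, h2, rfl, rfl⟩
    exact isTangent_of_hasDerivAt (.of_forall h2)
      ((h1.differentiable (by simp)).differentiableAt.hasDerivAt)
  · intro h
    refine ⟨fun s => conjExp (s • ad H P) P, (contDiff_conjExp _ _).of_le (by simp), fun t =>
      conjExp_mem hP (smul_skew (conjTranspose_ad_of_isTangent hP.1 h) t), ?_, ?_⟩
    · simp [conjExp]
    · rw [(hasDerivAt_conjExp _ _ _).deriv, ad_ad_of_isTangent hP.2.1 h]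
      simp [conjExp]

/-! ### The upper bound for the distance -/

theorem riemExp_eq (Q ξ : Mat n) : riemExp Q ξ = conjExp (ad ξ Q) Q := rfl

theorem metric_conjExp (Ω X : Mat n) :
    metric (conjExp Ω X) (conjExp Ω X) = metric X X := by
  have : conjExp Ω X * conjExp Ω X = conjExp Ω (X * X) := by
    calc conjExp Ω X * conjExp Ω X
        = NormedSpace.exp Ω * X * (NormedSpace.exp (-Ω) * NormedSpace.exp Ω) * X *
          NormedSpace.exp (-Ω) := by simp only [conjExp, mul_assoc]
      _ = conjExp Ω (X * X) := by
        rw [exp_neg_mul_exp, mul_one, mul_assoc _ X X, conjExp]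
  rw [metric, this, conjExp, Matrix.trace_mul_comm, ← mul_assoc, exp_neg_mul_exp, one_mul, metric]

theorem curveLength_nonneg (γ : ℝ → Mat n) : 0 ≤ curveLength γ :=
  intervalIntegral.integral_nonneg zero_le_one fun _ _ => Real.sqrt_nonneg _

/-- The witness is the geodesic run backwards; its speed is constant because its velocity is, up to
sign, a conjugate of `ξ`. -/
theorem exists_curve (hQ : Q ∈ Gr m n) (hξ : IsTangent Q ξ) :
    ∃ γ : ℝ → Mat n, ContDiff ℝ 1 γ ∧ (∀ t ∈ Set.Icc (0 : ℝ) 1, γ t ∈ Gr m n) ∧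
    γ 0 = riemExp Q ξ ∧ γ 1 = Q ∧ √(metric ξ ξ) = curveLength γ := by
  have hs := conjTranspose_ad_of_isTangent hQ.1 hξ
  have hd : ∀ t : ℝ, HasDerivAt (fun t : ℝ => conjExp ((1 - t) • ad ξ Q) Q)
      ((-1 : ℝ) • conjExp ((1 - t) • ad ξ Q) ξ) t := fun t => by
    have h1 := hasDerivAt_conjExp (ad ξ Q) Q (1 - t)
    rw [ad_ad_of_isTangent hQ.2.1 hξ] at h1
    exact h1.scomp t ((hasDerivAt_id t).const_sub 1)
  refine ⟨fun t => conjExp ((1 - t) • ad ξ Q) Q,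
    ((contDiff_conjExp (ad ξ Q) Q).comp (contDiff_const.sub contDiff_id)).of_le (by simp),
    fun t _ => conjExp_mem hQ (smul_skew hs _), by simp [riemExp_eq], by simp [conjExp], ?_⟩
  have h2 : ∀ t, metric (deriv (fun t : ℝ => conjExp ((1 - t) • ad ξ Q) Q) t)
      (deriv (fun t : ℝ => conjExp ((1 - t) • ad ξ Q) Q) t) = metric ξ ξ := fun t => by
    rw [(hd t).deriv, ← metric_conjExp ((1 - t) • ad ξ Q) ξ]
    simp [metric]
  simp only [curveLength, h2]
  simp


/-! ### The lower bound for lengths of curves of unitary matrices -/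

/-- A velocity tangent to the sphere at `u` pairs only with the part of `e` orthogonal to `u`, whose
length is the square root on the right. -/
theorem abs_inner_velocity_le {E : Type*} [NormedAddCommGroup E] [InnerProductSpace ℝ E]
    {e u w : E} (he : ‖e‖ = 1) (hu : ‖u‖ = 1) (h : inner ℝ u w = 0) :
    |inner ℝ e w| ≤ ‖w‖ * √(1 - inner ℝ e u ^ 2) := by
  have h1 : inner ℝ e w = inner ℝ (e - (inner ℝ e u : ℝ) • u) w := by
    rw [inner_sub_left, real_inner_smul_left, h, mul_zero, sub_zero]
  have h2 : ‖e - (inner ℝ e u : ℝ) • u‖ = √(1 - inner ℝ e u ^ 2) := by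
    rw [← Real.sqrt_sq (norm_nonneg (e - (inner ℝ e u : ℝ) • u)), norm_sub_sq_real,
      real_inner_smul_right, norm_smul, he, hu, Real.norm_eq_abs, mul_one, sq_abs]
    congr 1; ring
  rw [h1, mul_comm, ← h2]
  exact abs_real_inner_le_norm _ _

/-- The damping factor `c < 1` keeps `arccos` away from its singularities at `±1`, and costs nothing
since `c √(1 - x²) ≤ √(1 - (c x)²)`. -/
theorem neg_arccos_velocity_le {c x y v : ℝ} (hc : c ∈ Set.Ioo (0 : ℝ) 1)
    (hx : |x| ≤ 1) (hv : 0 ≤ v) (hy : |y| ≤ v * √(1 - x ^ 2)) :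
    -(-(1 / √(1 - (c * x) ^ 2)) * (c * y)) ≤ v := by
  have hx2 : x ^ 2 ≤ 1 := by rwa [sq_le_one_iff_abs_le_one]
  have hc2 : c ^ 2 < 1 := by nlinarith [hc.1, hc.2]
  have hpos : 0 < 1 - (c * x) ^ 2 := by rw [mul_pow]; nlinarith [sq_nonneg x, sq_nonneg c]
  have h1 : c * √(1 - x ^ 2) ≤ √(1 - (c * x) ^ 2) := by
    apply Real.le_sqrt_of_sq_le
    rw [mul_pow, Real.sq_sqrt (by linarith), mul_pow]
    nlinarith
  rw [neg_mul, neg_neg, one_div, inv_mul_le_iff₀ (Real.sqrt_pos.2 hpos)]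
  calc c * y ≤ c * (v * √(1 - x ^ 2)) :=
        mul_le_mul_of_nonneg_left ((le_abs_self y).trans hy) hc.1.le
    _ = (c * √(1 - x ^ 2)) * v := by ring
    _ ≤ √(1 - (c * x) ^ 2) * v := mul_le_mul_of_nonneg_right h1 hv

/-- A column of a matrix as a vector of the Euclidean space. -/
def colVec (X : Mat n) (i : Fin n) : EuclideanSpace ℂ (Fin n) :=
  WithLp.toLp 2 fun j => X j i

theorem inner_colVec (X Y : Mat n) (i j : Fin n) :
    inner ℝ (colVec X i) (colVec Y j) = ((Xᴴ * Y) i j).re := by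
  simp [colVec, PiLp.inner_apply, Matrix.mul_apply, Complex.inner, Complex.re_sum]
  exact Finset.sum_congr rfl fun _ _ => by ring

theorem norm_colVec {X : Mat n} (hX : Xᴴ * X = 1) (i : Fin n) : ‖colVec X i‖ = 1 := by
  rw [← sq_eq_sq₀ (norm_nonneg _) zero_le_one, ← real_inner_self_eq_norm_sq, inner_colVec, hX]
  simp

theorem sum_norm_colVec_sq (X : Mat n) : ∑ i, ‖colVec X i‖ ^ 2 = (Xᴴ * X).trace.re := by
  simp only [← real_inner_self_eq_norm_sq, inner_colVec, Matrix.trace, Matrix.diag, Complex.re_sum]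

theorem hasDerivAt_entry_re {N : ℝ → Mat n} {N' : Mat n} {t : ℝ} (h : HasDerivAt N N' t)
    (i j : Fin n) : HasDerivAt (fun s => (N s i j).re) (N' i j).re t := by
  let l : Mat n →ₗ[ℝ] ℝ :=
    { toFun := fun X => (X i j).re, map_add' := by simp, map_smul' := by simp }
  exact (LinearMap.toContinuousLinearMap l).hasFDerivAt.comp_hasDerivAt t h

theorem continuous_entry_re (i j : Fin n) : Continuous fun X : Mat n => (X i j).re :=
  Complex.continuous_re.comp ((continuous_apply j).comp (continuous_apply i))

theorem continuous_trace_re : Continuous fun X : Mat n => X.trace.re :=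
  Complex.continuous_re.comp continuous_id.matrix_trace

theorem continuous_speed {N : ℝ → Mat n} (hN : ContDiff ℝ 1 N) :
    Continuous fun t => √((deriv N t)ᴴ * deriv N t).trace.re := by
  have h := hN.continuous_deriv le_rfl
  exact Real.continuous_sqrt.comp (continuous_trace_re.comp (h.star.mul h))

theorem abs_entry_velocity_le {N : ℝ → Mat n} {N' : Mat n} {t : ℝ} (h : HasDerivAt N N' t)
    (hN : ∀ᶠ s in nhds t, (N s)ᴴ * N s = 1) (i : Fin n) :
    |(N' i i).re| ≤ ‖colVec N' i‖ * √(1 - (N t i i).re ^ 2) := by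
  have hNt := hN.self_of_nhds
  have h1 : (N')ᴴ * N t + (N t)ᴴ * N' = 0 :=
    (h.star.mul h).unique ((hasDerivAt_const t 1).congr_of_eventuallyEq hN)
  have h2 : inner ℝ (colVec (N t) i) (colVec N' i) = 0 := by
    have h3 : inner ℝ (colVec N' i) (colVec (N t) i) + inner ℝ (colVec (N t) i) (colVec N' i)
        = 0 := by
      rw [inner_colVec, inner_colVec, ← Complex.add_re, ← Matrix.add_apply, h1]; simp
    rw [real_inner_comm] at h3
    linarith
  have h4 := abs_inner_velocity_le (norm_colVec (X := 1) (by simp) i) (norm_colVec hNt i) h2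
  simpa [inner_colVec] using h4

theorem abs_entry_re_le {X : Mat n} (hX : Xᴴ * X = 1) (i : Fin n) : |(X i i).re| ≤ 1 := by
  have h4 := abs_real_inner_le_norm (colVec (1 : Mat n) i) (colVec X i)
  rw [norm_colVec (X := 1) (by simp) i, norm_colVec hX i] at h4
  simpa [inner_colVec] using h4

/-- The damped angle between column `i` and the `i`-th basis vector decreases no faster than the
column moves. Integrate the weighted sum of these bounds after applying Cauchy–Schwarz over the
columns. -/
theorem sum_arccos_sub_le {N : ℝ → Mat n} (hN : ContDiff ℝ 1 N)
    (hu : ∀ t ∈ Set.Icc (0 : ℝ) 1, (N t)ᴴ * N t = 1) (a : Fin n → ℝ) (ha : ∀ i, 0 ≤ a i)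
    {c : ℝ} (hc : c ∈ Set.Ioo (0 : ℝ) 1) :
    ∑ i, a i * (Real.arccos (c * (N 0 i i).re) - Real.arccos (c * (N 1 i i).re)) ≤
      √(∑ i, a i ^ 2) * ∫ t in (0 : ℝ)..1, √((deriv N t)ᴴ * deriv N t).trace.re := by
  have hd : ∀ t, HasDerivAt N (deriv N t) t := fun t =>
    (hN.differentiable one_ne_zero).differentiableAt.hasDerivAt
  have hlt : ∀ t ∈ Set.Icc (0 : ℝ) 1, ∀ i, |c * (N t i i).re| < 1 := fun t ht i => by
    rw [abs_mul, abs_of_pos hc.1]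
    nlinarith [abs_entry_re_le (hu t ht) i, hc.1, hc.2, abs_nonneg (N t i i).re]
  set Φ' : ℝ → ℝ := fun t => ∑ i, a i *
    -(-(1 / √(1 - (c * (N t i i).re) ^ 2)) * (c * (deriv N t i i).re)) with hΦ'
  have hΦ : ∀ t ∈ Set.uIcc (0 : ℝ) 1,
      HasDerivAt (fun t => ∑ i, a i * -Real.arccos (c * (N t i i).re)) (Φ' t) t := by
    intro t ht
    rw [Set.uIcc_of_le zero_le_one] at ht
    refine HasDerivAt.fun_sum fun i _ => ?_
    have h1 := abs_lt.1 (hlt t ht i)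
    exact ((((Real.hasDerivAt_arccos h1.1.ne' h1.2.ne).comp t
      ((hasDerivAt_entry_re (hd t) i i).const_mul c))).neg).const_mul (a i)
  have hcont : ContinuousOn Φ' (Set.uIcc (0 : ℝ) 1) := by
    rw [Set.uIcc_of_le zero_le_one]
    refine continuousOn_finsetSum _ fun i _ => ContinuousOn.mul continuousOn_const
      (ContinuousOn.neg (ContinuousOn.mul (ContinuousOn.neg (ContinuousOn.div continuousOn_const
      ?_ ?_)) ?_))
    · exact (Real.continuous_sqrt.comp (continuous_const.sub ((continuous_const.mul
        ((continuous_entry_re i i).comp hN.continuous)).pow 2))).continuousOn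
    · intro t ht
      refine (Real.sqrt_pos.2 ?_).ne'
      have := (sq_lt_one_iff_abs_lt_one (c * (N t i i).re)).2 (hlt t ht i)
      linarith
    · exact (continuous_const.mul ((continuous_entry_re i i).comp
        (hN.continuous_deriv le_rfl))).continuousOn
  have hint := intervalIntegral.integral_eq_sub_of_hasDerivAt hΦ hcont.intervalIntegrable
  have hle : ∀ t ∈ Set.Ioo (0 : ℝ) 1,
      Φ' t ≤ √(∑ i, a i ^ 2) * √((deriv N t)ᴴ * deriv N t).trace.re := by
    intro t ht
    have hev : ∀ᶠ s in nhds t, (N s)ᴴ * N s = 1 :=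
      Filter.eventually_of_mem (Ioo_mem_nhds ht.1 ht.2) fun s hs => hu s ⟨hs.1.le, hs.2.le⟩
    calc Φ' t ≤ ∑ i, a i * ‖colVec (deriv N t) i‖ :=
          Finset.sum_le_sum fun i _ => mul_le_mul_of_nonneg_left
            (neg_arccos_velocity_le hc (abs_entry_re_le hev.self_of_nhds i) (norm_nonneg _)
              (abs_entry_velocity_le (hd t) hev i)) (ha i)
      _ ≤ √(∑ i, a i ^ 2) * √(∑ i, ‖colVec (deriv N t) i‖ ^ 2) :=
          Real.sum_mul_le_sqrt_mul_sqrt _ _ _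
      _ = _ := by rw [sum_norm_colVec_sq]
  have hcs : Continuous fun t => √(∑ i, a i ^ 2) * √((deriv N t)ᴴ * deriv N t).trace.re :=
    continuous_const.mul (continuous_speed hN)
  have hmono := intervalIntegral.integral_mono_on_of_le_Ioo (μ := MeasureTheory.volume) zero_le_one
    hcont.intervalIntegrable (hcs.intervalIntegrable 0 1) hle
  rw [hint, intervalIntegral.integral_const_mul] at hmono
  refine le_trans (le_of_eq ?_) hmono
  rw [← Finset.sum_sub_distrib]
  exact Finset.sum_congr rfl fun i _ => by ring

/-- With weights `|θ i|` and `c → 1`, the damped estimate becomes `∑ θ i ^ 2 ≤ √(∑ θ i ^ 2) * ℓ`,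
and one root cancels. -/
theorem sqrt_sum_sq_le_length {N : ℝ → Mat n} (hN : ContDiff ℝ 1 N)
    (hu : ∀ t ∈ Set.Icc (0 : ℝ) 1, (N t)ᴴ * N t = 1) (θ : Fin n → ℝ)
    (hθ : ∀ i, |θ i| ≤ Real.pi) (h0 : ∀ i, (N 0 i i).re = Real.cos (θ i)) (h1 : N 1 = 1) :
    √(∑ i, θ i ^ 2) ≤ ∫ t in (0 : ℝ)..1, √((deriv N t)ᴴ * deriv N t).trace.re := by
  set ℓ := ∫ t in (0 : ℝ)..1, √((deriv N t)ᴴ * deriv N t).trace.re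
  have hℓ : 0 ≤ ℓ := intervalIntegral.integral_nonneg zero_le_one fun _ _ => Real.sqrt_nonneg _
  have hlim : Filter.Tendsto (fun c : ℝ => ∑ i, |θ i| * (Real.arccos (c * Real.cos (θ i)) -
      Real.arccos (c * 1))) (nhdsWithin 1 (Set.Iio 1))
      (nhds (∑ i, |θ i| * (Real.arccos (1 * Real.cos (θ i)) - Real.arccos (1 * 1)))) := by
    refine Filter.Tendsto.mono_left (Continuous.tendsto ?_ 1) nhdsWithin_le_nhds
    exact continuous_finsetSum _ fun i _ => continuous_const.mul
      ((Real.continuous_arccos.comp (continuous_id.mul continuous_const)).sub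
        (Real.continuous_arccos.comp (continuous_id.mul continuous_const)))
  have hle := le_of_tendsto hlim (b := √(∑ i, |θ i| ^ 2) * ℓ) (by
    filter_upwards [Ioo_mem_nhdsLT (zero_lt_one' ℝ)] with c hc
    have := sum_arccos_sub_le hN hu (fun i => |θ i|) (fun i => abs_nonneg _) hc
    simpa [h0, h1] using this)
  have hsum : ∑ i, |θ i| * (Real.arccos (1 * Real.cos (θ i)) - Real.arccos (1 * 1)) =
      ∑ i, θ i ^ 2 := by
    refine Finset.sum_congr rfl fun i _ => ?_
    rw [one_mul, one_mul, Real.arccos_one, sub_zero, ← Real.cos_abs,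
      Real.arccos_cos (abs_nonneg _) (hθ i), abs_mul_abs_self, sq]
  simp only [sq_abs, hsum] at hle
  have hs : 0 ≤ ∑ i, θ i ^ 2 := Finset.sum_nonneg fun i _ => sq_nonneg _
  rcases (Real.sqrt_nonneg (∑ i, θ i ^ 2)).eq_or_lt with h | h
  · rw [← h]; exact hℓ
  · nth_rewrite 1 [← Real.mul_self_sqrt hs] at hle
    exact le_of_mul_le_mul_left hle h

open Matrix in
theorem exists_unitary_diagonalization {L : Mat n} (hL : Lᴴ = -L) :
    ∃ (V : Mat n) (θ : Fin n → ℝ), Vᴴ * V = 1 ∧ V * Vᴴ = 1 ∧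
      Vᴴ * L * V = diagonal (fun i => (θ i : ℂ) * Complex.I) := by
  obtain ⟨A, hA, rfl⟩ : ∃ A : Mat n, A.IsHermitian ∧ L = Complex.I • A :=
    ⟨(-Complex.I) • L, by simp [Matrix.IsHermitian, conjTranspose_smul, hL], by simp [smul_smul]⟩
  have hV := hA.eigenvectorUnitary.2
  rw [Matrix.mem_unitaryGroup_iff'] at hV
  have hV' := hA.eigenvectorUnitary.2
  rw [Matrix.mem_unitaryGroup_iff] at hV'
  refine ⟨hA.eigenvectorUnitary, hA.eigenvalues, hV, hV', ?_⟩
  have h := hA.conjStarAlgAut_star_eigenvectorUnitary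
  rw [Unitary.conjStarAlgAut_star_apply] at h
  rw [mul_smul_comm, smul_mul_assoc]
  change Complex.I • (star (hA.eigenvectorUnitary : Mat n) * A * _) = _
  rw [h, ← diagonal_smul]
  congr 1
  funext i
  simp [mul_comm]

/-- Conjugating by a unitary that diagonalizes `L` preserves speeds and the endpoint `1`. The bound
by `π ^ 2` puts every eigenangle in `[-π, π]`, where `arccos (cos θ) = |θ|`. -/
theorem sqrt_trace_le_length {M : ℝ → Mat n} (hM : ContDiff ℝ 1 M)
    (hu : ∀ t ∈ Set.Icc (0 : ℝ) 1, (M t)ᴴ * M t = 1) {L : Mat n} (hL : Lᴴ = -L)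
    (hπ : -(L * L).trace.re ≤ Real.pi ^ 2) (h0 : M 0 = NormedSpace.exp L) (h1 : M 1 = 1) :
    √(-(L * L).trace.re) ≤ ∫ t in (0 : ℝ)..1, √((deriv M t)ᴴ * deriv M t).trace.re := by
  obtain ⟨V, θ, hV, hV', hD⟩ := exists_unitary_diagonalization hL
  have htr : -(L * L).trace.re = ∑ i, θ i ^ 2 := by
    have h2 : (L * L).trace = ((Vᴴ * L * V) * (Vᴴ * L * V)).trace := by
      have : (Vᴴ * L * V) * (Vᴴ * L * V) = Vᴴ * (L * (V * Vᴴ) * L * V) := by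
        simp only [mul_assoc]
      rw [this, Matrix.trace_mul_comm Vᴴ, hV', mul_one, mul_assoc, hV', mul_one]
    rw [h2, hD, Matrix.diagonal_mul_diagonal, Matrix.trace_diagonal, Complex.re_sum,
      ← Finset.sum_neg_distrib]
    exact Finset.sum_congr rfl fun i _ => by simp [sq]
  have hexp : Vᴴ * NormedSpace.exp L * V =
      Matrix.diagonal (fun i => NormedSpace.exp ((θ i : ℂ) * Complex.I)) := by
    have h2 := Matrix.exp_units_conj ⟨Vᴴ, V, hV, hV'⟩ L
    change NormedSpace.exp (Vᴴ * L * V) = Vᴴ * NormedSpace.exp L * V at h2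
    rw [← h2, hD, Matrix.exp_diagonal]
    congr 1
    funext i
    rw [Pi.coe_exp]
  have hd : ∀ t, HasDerivAt (fun t => Vᴴ * M t * V) (Vᴴ * deriv M t * V) t := fun t =>
    (((hM.differentiable one_ne_zero).differentiableAt.hasDerivAt).const_mul _).mul_const _
  have hspeed : ∀ t, ((deriv (fun t => Vᴴ * M t * V) t)ᴴ *
      deriv (fun t => Vᴴ * M t * V) t).trace.re = ((deriv M t)ᴴ * deriv M t).trace.re := by
    intro t
    rw [(hd t).deriv]
    have : (Vᴴ * deriv M t * V)ᴴ * (Vᴴ * deriv M t * V) =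
        Vᴴ * ((deriv M t)ᴴ * (V * Vᴴ) * deriv M t * V) := by
      simp only [Matrix.conjTranspose_mul, Matrix.conjTranspose_conjTranspose, mul_assoc]
    rw [this, Matrix.trace_mul_comm Vᴴ, hV', mul_one, mul_assoc, hV', mul_one]
  have hfin := sqrt_sum_sq_le_length (N := fun t => Vᴴ * M t * V)
    ((contDiff_const.mul hM).mul contDiff_const) (fun t ht => by
      have : (Vᴴ * M t * V)ᴴ * (Vᴴ * M t * V) = Vᴴ * ((M t)ᴴ * (V * Vᴴ) * M t) * V := by
        simp only [Matrix.conjTranspose_mul, Matrix.conjTranspose_conjTranspose, mul_assoc]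
      rw [this, hV', mul_one, hu t ht, mul_one, hV]) θ (fun i => by
      apply abs_le_of_sq_le_sq _ Real.pi_pos.le
      rw [htr] at hπ
      exact (Finset.single_le_sum (fun j _ => sq_nonneg (θ j)) (Finset.mem_univ i)).trans hπ)
    (fun i => by
      simp only [h0, hexp, Matrix.diagonal_apply_eq]
      rw [← Complex.exp_eq_exp_ℂ, Complex.exp_ofReal_mul_I_re])
    (by simp only [h1, mul_one, hV])
  simp only [hspeed] at hfin
  rwa [htr]


/-! ### The derivative of the exponential under the trace -/

theorem hasFDerivAt_exp (X : Mat n) :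
    HasFDerivAt NormedSpace.exp (fderiv ℝ NormedSpace.exp X) X :=
  (contDiff_exp.differentiable (by simp)).differentiableAt.hasFDerivAt

theorem fderiv_exp_two_smul (X K : Mat n) :
    fderiv ℝ NormedSpace.exp ((2 : ℝ) • X) ((2 : ℝ) • K) =
      NormedSpace.exp X * fderiv ℝ NormedSpace.exp X K +
        fderiv ℝ NormedSpace.exp X K * NormedSpace.exp X := by
  have h1 : HasFDerivAt (fun Y : Mat n => NormedSpace.exp ((2 : ℝ) • Y))
      ((fderiv ℝ NormedSpace.exp ((2 : ℝ) • X)).comp ((2 : ℝ) • ContinuousLinearMap.id ℝ _)) X :=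
    (hasFDerivAt_exp ((2 : ℝ) • X)).comp X ((hasFDerivAt_id X).const_smul (2 : ℝ))
  have h2 := (hasFDerivAt_exp X).mul' (hasFDerivAt_exp X)
  have h3 := h1.unique (h2.congr_of_eventuallyEq (.of_forall fun Y => exp_two_smul Y))
  simpa using congrArg (fun l => l K) h3

/-- Differentiating `exp (2Y) = exp Y * exp Y` gives two terms; cyclicity of the trace and `hA` make
them equal. -/
theorem trace_exp_neg_mul_fderiv_exp_two_smul {A X : Mat n} (hA : Commute A X) (K : Mat n) :
    (A * NormedSpace.exp (-((2 : ℝ) • X)) * fderiv ℝ NormedSpace.exp ((2 : ℝ) • X) K).trace =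
      (A * NormedSpace.exp (-X) * fderiv ℝ NormedSpace.exp X K).trace := by
  have h1 : fderiv ℝ NormedSpace.exp ((2 : ℝ) • X) K = (2⁻¹ : ℝ) •
      (NormedSpace.exp X * fderiv ℝ NormedSpace.exp X K +
        fderiv ℝ NormedSpace.exp X K * NormedSpace.exp X) := by
    rw [← fderiv_exp_two_smul, map_smul, smul_smul]; simp
  have h2 : NormedSpace.exp (-((2 : ℝ) • X)) = NormedSpace.exp (-X) * NormedSpace.exp (-X) := by
    rw [← smul_neg, exp_two_smul]
  have h3 : Commute A (NormedSpace.exp X) := hA.exp_right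
  set E := NormedSpace.exp X
  set E' := NormedSpace.exp (-X)
  set D := fderiv ℝ NormedSpace.exp X K
  have h4 : (A * (E' * E') * (E * D)).trace = (A * E' * D).trace := by
    have : A * (E' * E') * (E * D) = A * E' * (E' * E) * D := by simp only [mul_assoc]
    rw [this, exp_neg_mul_exp, mul_one]
  have h5 : (A * (E' * E') * (D * E)).trace = (A * E' * D).trace := by
    have : A * (E' * E') * (D * E) = (A * (E' * E') * D) * E := by simp only [mul_assoc]
    rw [this, Matrix.trace_mul_comm]
    have : E * (A * (E' * E') * D) = (E * A) * E' * E' * D := by simp only [mul_assoc]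
    rw [this, ← h3.eq, mul_assoc A E E', exp_mul_exp_neg, mul_one]
  rw [h1, h2, mul_smul_comm, Matrix.trace_smul, mul_add, Matrix.trace_add, h4, h5, ← two_smul ℝ,
    smul_smul]
  simp

/-- The left side is unchanged when `X` is halved, so it equals its limit at `X = 0`, where the
derivative of `exp` is the identity. No series for the derivative is needed. -/
theorem trace_exp_neg_mul_fderiv_exp {A X : Mat n} (hA : Commute A X) (K : Mat n) :
    (A * NormedSpace.exp (-X) * fderiv ℝ NormedSpace.exp X K).trace = (A * K).trace := by
  have hexp : Continuous (NormedSpace.exp : Mat n → Mat n) := contDiff_exp.continuous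
  have hτ : Continuous fun s : ℝ => (A * NormedSpace.exp (-(s • X)) *
      fderiv ℝ NormedSpace.exp (s • X) K).trace := by
    have h1 : Continuous fun s : ℝ => s • X := continuous_id.smul continuous_const
    have h2 : Continuous (fderiv ℝ (NormedSpace.exp : Mat n → Mat n)) :=
      contDiff_exp.continuous_fderiv (by simp)
    exact ((continuous_const.mul (hexp.comp h1.neg)).mul
      ((h2.comp h1).clm_apply continuous_const)).matrix_trace
  have hk : ∀ k : ℕ, (A * NormedSpace.exp (-(((1 / 2 : ℝ) ^ k) • X)) *
      fderiv ℝ NormedSpace.exp (((1 / 2 : ℝ) ^ k) • X) K).trace =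
      (A * NormedSpace.exp (-X) * fderiv ℝ NormedSpace.exp X K).trace := by
    intro k
    induction k with
    | zero => simp
    | succ k ih =>
      rw [← ih, ← trace_exp_neg_mul_fderiv_exp_two_smul (hA.smul_right _), smul_smul]
      have : (2 : ℝ) * (1 / 2) ^ (k + 1) = (1 / 2) ^ k := by rw [pow_succ]; ring
      rw [this]
  have hlim := (hτ.tendsto 0).comp
    (tendsto_pow_atTop_nhds_zero_of_lt_one (r := (1 / 2 : ℝ)) (by norm_num) (by norm_num))
  have h0 := tendsto_nhds_unique (tendsto_const_nhds.congr fun k => (hk k).symm) hlim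
  rw [h0, zero_smul, neg_zero, NormedSpace.exp_zero, mul_one,
    (hasStrictFDerivAt_exp_zero (𝕂 := ℝ)).hasFDerivAt.fderiv]
  rfl


/-! ### The Frobenius norm -/

/-- The square of the Frobenius norm. -/
def sqNorm (X : Mat n) : ℝ := (Xᴴ * X).trace.re

theorem continuous_sqNorm : Continuous (sqNorm : Mat n → ℝ) :=
  continuous_trace_re.comp (continuous_star.mul continuous_id)

theorem sq_norm_entry_le (X : Mat n) (i j : Fin n) : ‖X i j‖ ^ 2 ≤ sqNorm X := by
  rw [sqNorm, ← sum_norm_colVec_sq]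
  calc ‖X i j‖ ^ 2 ≤ ‖colVec X j‖ ^ 2 := by
        rw [EuclideanSpace.norm_sq_eq]
        exact Finset.single_le_sum (f := fun k => ‖(colVec X j) k‖ ^ 2)
          (fun k _ => sq_nonneg _) (Finset.mem_univ i)
    _ ≤ _ := Finset.single_le_sum (f := fun k => ‖colVec X k‖ ^ 2)
          (fun k _ => sq_nonneg _) (Finset.mem_univ j)

theorem sqNorm_nonneg (X : Mat n) : 0 ≤ sqNorm X := by
  rw [sqNorm, ← sum_norm_colVec_sq]
  exact Finset.sum_nonneg fun i _ => sq_nonneg _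

theorem eq_zero_of_sqNorm (h : sqNorm X = 0) : X = 0 := by
  ext i j
  have := sq_norm_entry_le X i j
  rw [h] at this
  simpa using le_antisymm this (sq_nonneg _)

theorem exists_sqNorm_ball_subset {s : Set (Mat n)} (hs : s ∈ nhds (0 : Mat n)) :
    ∃ r : ℝ, 0 < r ∧ ∀ X, sqNorm X < r ^ 2 → X ∈ s := by
  -- The matrix topology is the product topology, so neighbourhoods can be tested with the sup
  -- metric on entries.
  have hs' : s ∈ @nhds (Fin n → Fin n → ℂ) _ 0 := hs
  obtain ⟨r, hr, h⟩ := Metric.mem_nhds_iff.1 hs'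
  refine ⟨r, hr, fun X hX => h ?_⟩
  refine (dist_pi_lt_iff hr).2 fun i => (dist_pi_lt_iff hr).2 fun j => ?_
  have h1 : ‖X i j‖ < r := lt_of_pow_lt_pow_left₀ 2 hr.le ((sq_norm_entry_le X i j).trans_lt hX)
  rwa [← dist_zero_right] at h1

theorem sqNorm_neg : sqNorm (-X) = sqNorm X := by simp [sqNorm]

theorem sqNorm_conjTranspose : sqNorm Xᴴ = sqNorm X := by
  rw [sqNorm, Matrix.conjTranspose_conjTranspose, Matrix.trace_mul_comm, sqNorm]

theorem sqNorm_conj_of_mul_self (h1 : Yᴴ = Y) (h2 : Y * Y = 1) : sqNorm (Y * X * Y) = sqNorm X := by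
  have : (Y * X * Y)ᴴ * (Y * X * Y) = Y * (Xᴴ * (Y * Y) * X * Y) := by
    simp only [Matrix.conjTranspose_mul, h1, mul_assoc]
  rw [sqNorm, this, Matrix.trace_mul_comm, h2, mul_one, mul_assoc, h2, mul_one, sqNorm]

theorem sqNorm_two_smul : sqNorm ((2 : ℝ) • X) = 4 * sqNorm X := by
  simp only [sqNorm, Matrix.conjTranspose_smul, smul_mul_assoc, mul_smul_comm, smul_smul,
    Matrix.trace_smul, Complex.smul_re, star_trivial, smul_eq_mul]
  ring

theorem sqNorm_of_skew (h : Ωᴴ = -Ω) : sqNorm Ω = -(Ω * Ω).trace.re := by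
  rw [sqNorm, h, neg_mul, Matrix.trace_neg, Complex.neg_re]

theorem metric_self_eq_sqNorm (h : ξᴴ = ξ) : metric ξ ξ = sqNorm ξ := by
  rw [sqNorm, h, metric]

theorem sqNorm_ad (hQ : Q ∈ Gr m n) (hξ : IsTangent Q ξ) : sqNorm (ad ξ Q) = metric ξ ξ := by
  rw [sqNorm_of_skew (conjTranspose_ad_of_isTangent hQ.1 hξ), metric,
    trace_mul_self_of_isTangent hQ.2.1 hξ, Complex.neg_re]

theorem re_trace_mul_of_skew (hΩ : Ωᴴ = -Ω) (hH : Hᴴ = H) : (Ω * H).trace.re = 0 := by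
  have h1 : (Ω * H).trace.re = -(Ω * H).trace.re := by
    conv_lhs => rw [← Complex.conj_re, ← Complex.star_def, ← Matrix.trace_conjTranspose,
      Matrix.conjTranspose_mul, hΩ, hH, mul_neg, Matrix.trace_neg, Complex.neg_re,
      Matrix.trace_mul_comm]
  linarith

theorem contDiff_refl_mul (Q : Mat n) : ContDiff ℝ ω fun X : Mat n => refl X * refl Q := by
  have h : ContDiff ℝ ω fun X : Mat n => (1 : Mat n) - (2 : ℝ) • X :=
    contDiff_const.sub (contDiff_id.const_smul (2 : ℝ))
  exact h.mul contDiff_const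

theorem hasDerivAt_refl_mul {γ : ℝ → Mat n} {t : ℝ} (h : HasDerivAt γ H t) (Q : Mat n) :
    HasDerivAt (fun t => refl (γ t) * refl Q) (-((2 : ℝ) • H) * refl Q) t := by
  have h1 : HasDerivAt (fun t => (1 : Mat n) - (2 : ℝ) • γ t) (-((2 : ℝ) • H)) t :=
    (h.const_smul (2 : ℝ)).const_sub 1
  exact h1.mul_const _

/-! ### The distance to `Q` -/

/-- The unitary bound is applied to `refl (γ t) * refl Q`, which starts at `exp (2[ξ,Q])` and moves
at twice the speed of `γ`; the factors 2 cancel. -/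
theorem sqrt_metric_le_curveLength (hQ : Q ∈ Gr m n) (hξ : IsTangent Q ξ) (h1 : metric ξ ξ ≤ 1)
    {γ : ℝ → Mat n} (hγ : ContDiff ℝ 1 γ) (hGr : ∀ t ∈ Set.Icc (0 : ℝ) 1, γ t ∈ Gr m n)
    (h0 : γ 0 = riemExp Q ξ) (hγ1 : γ 1 = Q) : √(metric ξ ξ) ≤ curveLength γ := by
  have hR := refl_mul_refl hQ.2.1
  have hR' := conjTranspose_refl hQ.1
  have hs := conjTranspose_ad_of_isTangent hQ.1 hξ
  have hM : ContDiff ℝ 1 fun t => refl (γ t) * refl Q :=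
    ((contDiff_refl_mul Q).of_le (by simp)).comp hγ
  have hd : ∀ t, HasDerivAt (fun t => refl (γ t) * refl Q) (-((2 : ℝ) • deriv γ t) * refl Q) t :=
    fun t => hasDerivAt_refl_mul (hγ.differentiable one_ne_zero).differentiableAt.hasDerivAt Q
  have hL : -(((2 : ℝ) • ad ξ Q) * ((2 : ℝ) • ad ξ Q)).trace.re = 2 ^ 2 * metric ξ ξ := by
    rw [← sqNorm_of_skew (smul_skew hs 2), sqNorm_two_smul, sqNorm_ad hQ hξ]
    norm_num
  have hlow := sqrt_trace_le_length hM (fun t ht => by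
      have hG := hGr t ht
      rw [Matrix.conjTranspose_mul, hR', conjTranspose_refl hG.1, mul_assoc,
        ← mul_assoc (refl (γ t)), refl_mul_refl hG.2.1, one_mul, hR]) (smul_skew hs 2)
    -- The eigenangle condition reads `4 tr ξ² ≤ π²`, which `tr ξ² ≤ 1` ensures.
    (by rw [hL]; nlinarith [Real.pi_gt_three])
    (by rw [h0, riemExp_eq, refl_mul_refl_conjExp hQ.2.1 (refl_mul_ad hQ.2.1 hξ)])
    (by rw [hγ1, hR])
  rw [hL, Real.sqrt_mul (by norm_num), Real.sqrt_sq (by norm_num)] at hlow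
  have hcont : Continuous fun t => 2 * √(metric (deriv γ t) (deriv γ t)) := by
    have h := hγ.continuous_deriv le_rfl
    exact continuous_const.mul (Real.continuous_sqrt.comp (continuous_trace_re.comp (h.mul h)))
  have hle : ∫ t in (0 : ℝ)..1, √((deriv (fun t => refl (γ t) * refl Q) t)ᴴ *
      deriv (fun t => refl (γ t) * refl Q) t).trace.re ≤
      ∫ t in (0 : ℝ)..1, 2 * √(metric (deriv γ t) (deriv γ t)) := by
    refine intervalIntegral.integral_mono_on_of_le_Ioo (μ := MeasureTheory.volume) zero_le_one
      ((continuous_speed hM).intervalIntegrable 0 1) (hcont.intervalIntegrable 0 1) ?_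
    intro t ht
    have hH : IsTangent (γ t) (deriv γ t) := isTangent_of_hasDerivAt
      (Filter.eventually_of_mem (Ioo_mem_nhds ht.1 ht.2) fun s hs => hGr s ⟨hs.1.le, hs.2.le⟩)
      ((hγ.differentiable one_ne_zero).differentiableAt.hasDerivAt)
    have h4 : ((-((2 : ℝ) • deriv γ t) * refl Q)ᴴ * (-((2 : ℝ) • deriv γ t) * refl Q)).trace.re =
        2 ^ 2 * metric (deriv γ t) (deriv γ t) := by
      have : (-((2 : ℝ) • deriv γ t) * refl Q)ᴴ * (-((2 : ℝ) • deriv γ t) * refl Q) =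
          refl Q * ((2 ^ 2 : ℝ) • (deriv γ t * deriv γ t) * refl Q) := by
        rw [Matrix.conjTranspose_mul, Matrix.conjTranspose_neg, Matrix.conjTranspose_smul, hH.1,
          hR', star_trivial]
        simp only [neg_mul, mul_neg, smul_mul_assoc, mul_smul_comm, mul_assoc]
        module
      rw [this, Matrix.trace_mul_comm, mul_assoc, hR, mul_one, Matrix.trace_smul,
        Complex.smul_re, smul_eq_mul, metric]
    rw [(hd t).deriv, h4, Real.sqrt_mul (by norm_num), Real.sqrt_sq (by norm_num)]
  rw [intervalIntegral.integral_const_mul] at hle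
  have := hlow.trans hle
  rw [curveLength]
  linarith

theorem dist_riemExp (hQ : Q ∈ Gr m n) (hξ : IsTangent Q ξ) (h1 : metric ξ ξ ≤ 1) :
    dist m (riemExp Q ξ) Q = √(metric ξ ξ) := by
  refine le_antisymm (csInf_le ⟨0, ?_⟩ (exists_curve hQ hξ))
    (le_csInf ⟨_, exists_curve hQ hξ⟩ ?_)
  · rintro _ ⟨γ, -, -, -, -, rfl⟩
    exact curveLength_nonneg γ
  · rintro _ ⟨γ, hγ, hG, h0, hγ1, rfl⟩
    exact sqrt_metric_le_curveLength hQ hξ h1 hγ hG h0 hγ1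

theorem dist_riemExp_sq (hQ : Q ∈ Gr m n) (hξ : IsTangent Q ξ) (h1 : metric ξ ξ ≤ 1) :
    dist m (riemExp Q ξ) Q ^ 2 = metric ξ ξ := by
  rw [dist_riemExp hQ hξ h1, Real.sq_sqrt]
  rw [metric_self_eq_sqNorm hξ.1]
  exact sqNorm_nonneg _

theorem trace_mul_self_eq_metric (hξ : ξᴴ = ξ) : (ξ * ξ).trace = ((metric ξ ξ : ℝ) : ℂ) := by
  have h : star (ξ * ξ).trace = (ξ * ξ).trace := by
    rw [← Matrix.trace_conjTranspose, Matrix.conjTranspose_mul, hξ]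
  exact (Complex.conj_eq_iff_re.1 h).symm

/-! ### The local logarithm -/

/-- `e` is a local inverse of the exponential, with inverse analytic on the image of the Frobenius
ball of radius `2 r`. -/
structure IsLogChart (e : OpenPartialHomeomorph (Mat n) (Mat n)) (r : ℝ) : Prop where
  pos : 0 < r
  le_one : r ≤ 1
  coe_eq : ⇑e = NormedSpace.exp
  mem_source : ∀ X, sqNorm X < (2 * r) ^ 2 → X ∈ e.source
  contDiffAt : ∀ X, sqNorm X < (2 * r) ^ 2 → ContDiffAt ℝ ω e.symm (NormedSpace.exp X)

theorem exists_isLogChart (n : ℕ) :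
    ∃ (e : OpenPartialHomeomorph (Mat n) (Mat n)) (r : ℝ), IsLogChart e r := by
  have hf : ContDiffAt ℝ ω (NormedSpace.exp : Mat n → Mat n) 0 := contDiff_exp.contDiffAt
  have hf' : HasFDerivAt (NormedSpace.exp : Mat n → Mat n)
      ((ContinuousLinearEquiv.refl ℝ (Mat n) : Mat n ≃L[ℝ] Mat n) : Mat n →L[ℝ] Mat n) 0 :=
    (hasStrictFDerivAt_exp_zero (𝕂 := ℝ)).hasFDerivAt
  set e := hf.toOpenPartialHomeomorph _ hf' (by simp) with he
  have hsymm : ContDiffAt ℝ ω e.symm (NormedSpace.exp 0) := hf.to_localInverse hf' (by simp)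
  have h1 : ∀ᶠ X in nhds (0 : Mat n), X ∈ e.source :=
    e.open_source.mem_nhds (hf.mem_toOpenPartialHomeomorph_source hf' (by simp))
  have h2 : ∀ᶠ X in nhds (0 : Mat n), ContDiffAt ℝ ω e.symm (NormedSpace.exp X) :=
    contDiff_exp.continuous.continuousAt.eventually (hsymm.eventually (by simp))
  obtain ⟨r, hr, h⟩ := exists_sqNorm_ball_subset (h1.and h2)
  -- Halving accounts for the ball of radius `2r` in the chart, as the logarithm is `2[ξ,Q]`; the
  -- cap at 1 is for the distance formula.
  have key : ∀ X : Mat n, sqNorm X < (2 * min (r / 2) 1) ^ 2 →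
      X ∈ e.source ∧ ContDiffAt ℝ ω e.symm (NormedSpace.exp X) := fun X hX => by
    refine h X (hX.trans_le ?_)
    have h3 : 0 < min (r / 2) 1 := lt_min (by linarith) one_pos
    have h4 := min_le_left (r / 2) 1
    exact pow_le_pow_left₀ (by linarith) (by linarith) 2
  exact ⟨e, min (r / 2) 1, lt_min (by linarith) one_pos, min_le_right _ _, rfl,
    fun X hX => (key X hX).1, fun X hX => (key X hX).2⟩

/-- The neighbourhood of `Q` on which the logarithm of `(1 - 2 X) (1 - 2 Q)` is defined and has
Frobenius norm less than `2 r`. -/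
def logDomain (Q : Mat n) (r : ℝ) : Set (Mat n) :=
  {X | ∃ L, sqNorm L < (2 * r) ^ 2 ∧ NormedSpace.exp L = refl X * refl Q}

section LogChart

variable {e : OpenPartialHomeomorph (Mat n) (Mat n)} {r : ℝ}

theorem IsLogChart.injOn (he : IsLogChart e r) (hX : sqNorm X < (2 * r) ^ 2)
    (hY : sqNorm Y < (2 * r) ^ 2) (h : NormedSpace.exp X = NormedSpace.exp Y) : X = Y := by
  rw [← he.coe_eq] at h
  exact e.injOn (he.mem_source X hX) (he.mem_source Y hY) h

theorem IsLogChart.symm_exp (he : IsLogChart e r) (hX : sqNorm X < (2 * r) ^ 2) :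
    e.symm (NormedSpace.exp X) = X := by
  rw [← he.coe_eq]
  exact e.left_inv (he.mem_source X hX)

theorem IsLogChart.isOpen_logDomain (he : IsLogChart e r) (Q : Mat n) :
    IsOpen (logDomain Q r) := by
  have h1 : IsOpen (e '' {L | sqNorm L < (2 * r) ^ 2}) :=
    e.isOpen_image_of_subset_source (isOpen_lt continuous_sqNorm continuous_const)
      fun X hX => he.mem_source X hX
  rw [he.coe_eq] at h1
  exact h1.preimage (contDiff_refl_mul Q).continuous

theorem IsLogChart.mem_logDomain_self (he : IsLogChart e r) (hQ : Q ∈ Gr m n) :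
    Q ∈ logDomain Q r := by
  refine ⟨0, ?_, by rw [NormedSpace.exp_zero, refl_mul_refl hQ.2.1]⟩
  have := he.pos
  simp only [sqNorm, mul_zero, Matrix.trace_zero, Complex.zero_re]
  positivity

theorem mem_tangentBall_iff (hQ : Q ∈ Gr m n) :
    ξ ∈ tangentBall m Q r ↔ IsTangent Q ξ ∧ metric ξ ξ < r ^ 2 := by
  rw [tangentBall, Set.mem_ofPred_eq, mem_tangentSpace_iff hQ]

theorem sqNorm_two_smul_ad_lt (hQ : Q ∈ Gr m n) (hξ : ξ ∈ tangentBall m Q r) :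
    sqNorm ((2 : ℝ) • ad ξ Q) < (2 * r) ^ 2 := by
  rw [mem_tangentBall_iff hQ] at hξ
  rw [sqNorm_two_smul, sqNorm_ad hQ hξ.1, mul_pow]
  linarith [hξ.2]

theorem exp_two_smul_ad (hQ : Q ∈ Gr m n) (hξ : ξ ∈ tangentBall m Q r) :
    NormedSpace.exp ((2 : ℝ) • ad ξ Q) = refl (riemExp Q ξ) * refl Q := by
  rw [mem_tangentBall_iff hQ] at hξ
  rw [riemExp_eq, refl_mul_refl_conjExp hQ.2.1 (refl_mul_ad hQ.2.1 hξ.1)]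

/-- Both the adjoint of `refl P * refl Q` and its conjugate by `refl Q` equal its inverse. The
Frobenius ball is stable under the corresponding operations on `L`, so injectivity of `exp` there
forces `Lᴴ = -L` and `refl Q * L * refl Q = -L`. Take `Ω = L / 2`. -/
theorem IsLogChart.exists_skew (he : IsLogChart e r) (hQ : Q ∈ Gr m n) (hP : P ∈ Gr m n)
    (hPU : P ∈ logDomain Q r) :
    ∃ Ω, Ωᴴ = -Ω ∧ refl Q * Ω = -(Ω * refl Q) ∧ sqNorm ((2 : ℝ) • Ω) < (2 * r) ^ 2 ∧
      NormedSpace.exp ((2 : ℝ) • Ω) = refl P * refl Q := by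
  obtain ⟨L, hL, hexp⟩ := hPU
  have hR := refl_mul_refl hQ.2.1
  have hR' := conjTranspose_refl hQ.1
  have hS := refl_mul_refl hP.2.1
  have hS' := conjTranspose_refl hP.1
  have hneg : NormedSpace.exp (-L) = refl Q * refl P := by
    have h1 : NormedSpace.exp (-L) * (refl P * refl Q) * (refl Q * refl P) = refl Q * refl P := by
      rw [← hexp, exp_neg_mul_exp, one_mul]
    rw [← h1, mul_assoc, mul_assoc (refl P), ← mul_assoc (refl Q) (refl Q), hR, one_mul, hS,
      mul_one]
  have hstar : Lᴴ = -L := by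
    refine he.injOn (by rwa [sqNorm_conjTranspose]) (by rwa [sqNorm_neg]) ?_
    rw [exp_conjTranspose, hexp, hneg, Matrix.conjTranspose_mul, hR', hS']
  have hconj : refl Q * L * refl Q = -L := by
    refine he.injOn (by rwa [sqNorm_conj_of_mul_self hR' hR]) (by rwa [sqNorm_neg]) ?_
    rw [exp_conj_of_mul_self hR, hexp, hneg, mul_assoc, mul_assoc, hR, mul_one]
  have h2 : (2 : ℝ) • (2⁻¹ : ℝ) • L = L := by rw [smul_smul]; simp
  refine ⟨(2⁻¹ : ℝ) • L, smul_skew hstar _, ?_, by rwa [h2], by rwa [h2]⟩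
  have h3 : refl Q * L = -(L * refl Q) := by
    rw [← neg_mul, ← hconj, mul_assoc _ (refl Q) (refl Q), hR, mul_one]
  rw [mul_smul_comm, h3, smul_mul_assoc, smul_neg]

theorem IsLogChart.bijOn_riemExp (he : IsLogChart e r) (hQ : Q ∈ Gr m n) :
    Set.BijOn (riemExp Q) (tangentBall m Q r) (logDomain Q r ∩ Gr m n) := by
  refine ⟨fun ξ hξ => ⟨⟨_, sqNorm_two_smul_ad_lt hQ hξ, exp_two_smul_ad hQ hξ⟩, ?_⟩, ?_, ?_⟩
  · rw [mem_tangentBall_iff hQ] at hξ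
    exact conjExp_mem hQ (conjTranspose_ad_of_isTangent hQ.1 hξ.1)
  · intro ξ hξ η hη h
    have h1 := he.injOn (sqNorm_two_smul_ad_lt hQ hξ) (sqNorm_two_smul_ad_lt hQ hη)
      (by rw [exp_two_smul_ad hQ hξ, exp_two_smul_ad hQ hη, h])
    have h2 := smul_right_injective _ (two_ne_zero : (2 : ℝ) ≠ 0) h1
    rw [← ad_ad_of_isTangent hQ.2.1 ((mem_tangentBall_iff hQ).1 hξ).1, h2,
      ad_ad_of_isTangent hQ.2.1 ((mem_tangentBall_iff hQ).1 hη).1]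
  · rintro P ⟨hPU, hP⟩
    obtain ⟨Ω, h1, h2, h3, h4⟩ := he.exists_skew hQ hP hPU
    have hξ := isTangent_ad hQ.1 hQ.2.1 h1
    have had := ad_ad_of_refl_mul hQ.2.1 h2
    refine ⟨ad Ω Q, (mem_tangentBall_iff hQ).2 ⟨hξ, ?_⟩, ?_⟩
    · rw [← sqNorm_ad hQ hξ, had]
      rw [sqNorm_two_smul, mul_pow] at h3
      linarith
    · apply eq_of_refl_eq
      rw [riemExp_eq, had, refl_conjExp hQ.2.1 h2, h4, mul_assoc, refl_mul_refl hQ.2.1, mul_one]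

/-! ### The gradient of the squared distance -/

/-- The function `-1/4 tr (log ((1 - 2 X) (1 - 2 Q))²)`, which extends the squared distance to `Q`
to an open set of matrices. -/
def sqLog (e : OpenPartialHomeomorph (Mat n) (Mat n)) (Q X : Mat n) : ℝ :=
  -(1 / 4) * (e.symm (refl X * refl Q) * e.symm (refl X * refl Q)).trace.re

theorem metric_le_one (he : IsLogChart e r) (hQ : Q ∈ Gr m n) (hξ : ξ ∈ tangentBall m Q r) :
    metric ξ ξ ≤ 1 :=
  ((mem_tangentBall_iff hQ).1 hξ).2.le.trans (pow_le_one₀ he.pos.le he.le_one)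

theorem IsLogChart.sqLog_eq (he : IsLogChart e r) (hQ : Q ∈ Gr m n)
    (hX : X ∈ logDomain Q r ∩ Gr m n) : sqLog e Q X = dist m X Q ^ 2 := by
  obtain ⟨ξ, hξ, rfl⟩ := (he.bijOn_riemExp hQ).surjOn hX
  have hT := ((mem_tangentBall_iff hQ).1 hξ).1
  have h1 := sqNorm_of_skew (smul_skew (conjTranspose_ad_of_isTangent hQ.1 hT) 2)
  rw [sqNorm_two_smul, sqNorm_ad hQ hT] at h1
  rw [dist_riemExp_sq hQ hT (metric_le_one he hQ hξ), sqLog, ← exp_two_smul_ad hQ hξ,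
    he.symm_exp (sqNorm_two_smul_ad_lt hQ hξ)]
  linarith

theorem IsLogChart.contDiffAt_log (he : IsLogChart e r) (hP : P ∈ logDomain Q r) :
    ContDiffAt ℝ ω (fun X => e.symm (refl X * refl Q)) P := by
  obtain ⟨L, hL, hexp⟩ := hP
  have h1 := he.contDiffAt L hL
  rw [hexp] at h1
  exact h1.comp P (contDiff_refl_mul Q).contDiffAt

/-- The real part of the trace, as a continuous linear map. -/
def traceReCLM (n : ℕ) : Mat n →L[ℝ] ℝ :=
  LinearMap.toContinuousLinearMap
    { toFun := fun X => X.trace.re, map_add' := by simp, map_smul' := by simp }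

theorem traceReCLM_apply (X : Mat n) : traceReCLM n X = X.trace.re := rfl

theorem IsLogChart.smoothAt (he : IsLogChart e r) (hQ : Q ∈ Gr m n) (hP : P ∈ logDomain Q r) :
    SmoothAt m (fun X => dist m X Q ^ 2) P := by
  refine ⟨sqLog e Q, ?_, ?_⟩
  · have h1 := he.contDiffAt_log hP
    exact (contDiffAt_const.mul ((traceReCLM n).contDiff.contDiffAt.comp P (h1.mul h1))).of_le
      (by simp)
  · filter_upwards [self_mem_nhdsWithin,
      mem_nhdsWithin_of_mem_nhds ((he.isOpen_logDomain Q).mem_nhds hP)] with X h1 h2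
    exact he.sqLog_eq hQ ⟨h2, h1⟩

/-- Taking adjoints shows that both terms of the bracket contribute equally, and `Re tr (Ω H) = 0`
allows replacing `2 P` by `-refl P`. -/
theorem re_trace_ad_mul (hP : Pᴴ = P) (hΩ : Ωᴴ = -Ω) (hH : Hᴴ = H) :
    metric (ad Ω P) H = -(Ω * refl P * H).trace.re := by
  have h1 : (P * Ω * H).trace.re = -(Ω * P * H).trace.re := by
    rw [← Complex.conj_re, ← Complex.star_def, ← Matrix.trace_conjTranspose,
      Matrix.conjTranspose_mul, Matrix.conjTranspose_mul, hP, hΩ, hH, neg_mul, mul_neg,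
      Matrix.trace_neg, Complex.neg_re, Matrix.trace_mul_comm]
  have h2 : Ω * refl P * H = Ω * H - (2 : ℝ) • (Ω * P * H) := by
    simp only [refl, mul_sub, sub_mul, mul_one, mul_smul_comm, smul_mul_assoc]
  rw [metric, ad, sub_mul, Matrix.trace_sub, Complex.sub_re, h1, h2, Matrix.trace_sub,
    Matrix.trace_smul, Complex.sub_re, Complex.smul_re, re_trace_mul_of_skew hΩ hH, smul_eq_mul]
  ring

/-- Let `L'` be the velocity of the logarithm, whose value at time 0 is `2Ω`; the derivative is `-Re
tr (Ω L')`. Since `Ω` commutes with `2Ω`, the trace identity for `exp` replaces `L'` by the explicit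
velocity of `refl (γ t) * refl Q`. -/
theorem IsLogChart.hasDerivAt_sqLog (he : IsLogChart e r) (hQ : Q ∈ Gr m n)
    (hξ : ξ ∈ tangentBall m Q r) (hH : Hᴴ = H) {γ : ℝ → Mat n} (h0 : γ 0 = riemExp Q ξ)
    (hγ : HasDerivAt γ H 0) :
    HasDerivAt (fun t => sqLog e Q (γ t)) (2 * metric (ad (ad ξ Q) (riemExp Q ξ)) H) 0 := by
  obtain ⟨hPU, hP⟩ := (he.bijOn_riemExp hQ).mapsTo hξ
  have hT := ((mem_tangentBall_iff hQ).1 hξ).1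
  have hR := refl_mul_refl hQ.2.1
  have hS := refl_mul_refl hP.2.1
  have hexp := exp_two_smul_ad hQ hξ
  have hskew := conjTranspose_ad_of_isTangent hQ.1 hT
  have hanti := refl_mul_ad hQ.2.1 hT
  have hlog0 : e.symm (refl (γ 0) * refl Q) = (2 : ℝ) • ad ξ Q := by
    rw [h0, ← hexp, he.symm_exp (sqNorm_two_smul_ad_lt hQ hξ)]
  rw [re_trace_ad_mul hP.1 hskew hH]
  set P := riemExp Q ξ
  set Ω := ad ξ Q
  obtain ⟨L', hL'⟩ : ∃ L', HasDerivAt (fun t => e.symm (refl (γ t) * refl Q)) L' 0 := by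
    have h1 := ((he.contDiffAt_log (Q := Q) (h0 ▸ hPU : γ 0 ∈ logDomain Q r)).differentiableAt
      (by simp)).hasFDerivAt
    exact ⟨_, h1.comp_hasDerivAt 0 hγ⟩
  have hD : fderiv ℝ NormedSpace.exp ((2 : ℝ) • Ω) L' = -((2 : ℝ) • H) * refl Q := by
    have h1 : HasDerivAt (fun t => NormedSpace.exp (e.symm (refl (γ t) * refl Q)))
        (fderiv ℝ NormedSpace.exp ((2 : ℝ) • Ω) L') 0 := by
      have h2 := hasFDerivAt_exp ((2 : ℝ) • Ω)
      rw [← hlog0] at h2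
      have h3 := h2.comp_hasDerivAt 0 hL'
      rw [hlog0] at h3
      exact h3
    have h2 : HasDerivAt (fun t => refl (γ t) * refl Q) (-((2 : ℝ) • H) * refl Q) 0 :=
        hasDerivAt_refl_mul hγ Q
    refine h1.unique (h2.congr_of_eventuallyEq ?_)
    have hev : ∀ᶠ t in nhds (0 : ℝ), γ t ∈ logDomain Q r :=
      hγ.continuousAt.eventually ((he.isOpen_logDomain Q).mem_nhds (by rwa [h0]))
    filter_upwards [hev] with t ht
    obtain ⟨L, hL, hexpL⟩ := ht
    rw [← hexpL, he.symm_exp hL]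
  have hneg : NormedSpace.exp (-((2 : ℝ) • Ω)) = refl Q * refl P := by
    have h1 : NormedSpace.exp (-((2 : ℝ) • Ω)) * (refl P * refl Q) * (refl Q * refl P) =
        refl Q * refl P := by
      rw [← hexp, exp_neg_mul_exp, one_mul]
    rw [← h1, mul_assoc, mul_assoc (refl P), ← mul_assoc (refl Q) (refl Q), hR, one_mul, hS,
      mul_one]
  have htr : (Ω * L').trace = (2 : ℝ) • (Ω * refl P * H).trace := by
    have h1 := trace_exp_neg_mul_fderiv_exp ((Commute.refl Ω).smul_right (2 : ℝ)) L'
    have h2 : Ω * (refl Q * refl P) * (-((2 : ℝ) • H) * refl Q) =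
        -((2 : ℝ) • ((Ω * refl Q * refl P * H) * refl Q)) := by
      simp only [neg_mul, mul_neg, smul_mul_assoc, mul_smul_comm, mul_assoc]
    have h3 : refl Q * (Ω * refl Q * refl P * H) = -(Ω * refl P * H) := by
      calc refl Q * (Ω * refl Q * refl P * H) = (refl Q * Ω) * refl Q * refl P * H := by
            simp only [mul_assoc]
        _ = -(Ω * (refl Q * refl Q) * refl P * H) := by
            rw [hanti]; simp only [neg_mul, mul_assoc]
        _ = _ := by rw [hR, mul_one]
    rw [← h1, hneg, hD, h2, Matrix.trace_neg, Matrix.trace_smul, Matrix.trace_mul_comm, h3,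
      Matrix.trace_neg, smul_neg, neg_neg]
  have hfin := (((traceReCLM n).hasFDerivAt.comp_hasDerivAt 0 (hL'.mul hL'))).const_mul
    (-(1 / 4) : ℝ)
  refine hfin.congr_deriv ?_
  rw [hlog0, traceReCLM_apply, Matrix.trace_add, Matrix.trace_mul_comm L', smul_mul_assoc,
    Matrix.trace_smul, htr]
  simp only [Complex.add_re, Complex.smul_re, smul_eq_mul]
  ring

theorem metric_two_smul (X Y : Mat n) : metric ((2 : ℂ) • X) Y = 2 * metric X Y := by
  simp [metric]

theorem IsLogChart.isRiemGrad (he : IsLogChart e r) (hQ : Q ∈ Gr m n)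
    (hξ : ξ ∈ tangentBall m Q r) :
    IsRiemGrad m (fun X => dist m X Q ^ 2) (riemExp Q ξ)
      ((2 : ℂ) • ad (ad ξ Q) (riemExp Q ξ)) := by
  obtain ⟨hPU, hP⟩ := (he.bijOn_riemExp hQ).mapsTo hξ
  have hT := ((mem_tangentBall_iff hQ).1 hξ).1
  have hskew := conjTranspose_ad_of_isTangent hQ.1 hT
  refine ⟨he.smoothAt hQ hPU, ?_, ?_⟩
  · rw [mem_tangentSpace_iff hP]
    have h1 := isTangent_ad hP.1 hP.2.1 hskew
    refine ⟨?_, ?_⟩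
    · rw [Matrix.conjTranspose_smul, h1.1]; simp
    · rw [smul_mul_assoc, mul_smul_comm, ← smul_add, h1.2]
  · intro H hH γ hG h0 hγ
    rw [mem_tangentSpace_iff hP] at hH
    rw [metric_two_smul]
    refine (he.hasDerivAt_sqLog hQ hξ hH.1 h0 hγ).congr_of_eventuallyEq ?_
    have hev : ∀ᶠ t in nhds (0 : ℝ), γ t ∈ logDomain Q r :=
      hγ.continuousAt.eventually ((he.isOpen_logDomain Q).mem_nhds (by rwa [h0]))
    filter_upwards [hev] with t ht
    exact (he.sqLog_eq hQ ⟨ht, hG t⟩).symm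

/-- Testing the derivative on `[[ξ,Q],P]` itself shows that this bracket vanishes, so `e^{-[ξ,Q]} P
e^{[ξ,Q]}` is `P`; by definition of `P` it is also `Q`. -/
theorem IsLogChart.isCriticalPt_iff (he : IsLogChart e r) (hQ : Q ∈ Gr m n)
    (hP : P ∈ logDomain Q r ∩ Gr m n) :
    IsCriticalPt m (fun X => dist m X Q ^ 2) P ↔ P = Q := by
  obtain ⟨ξ, hξ, rfl⟩ := (he.bijOn_riemExp hQ).surjOn hP
  have hT := ((mem_tangentBall_iff hQ).1 hξ).1
  have hgrad := he.isRiemGrad hQ hξ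
  constructor
  · intro hcrit
    have h1 := isTangent_ad hP.2.1 hP.2.2.1 (conjTranspose_ad_of_isTangent hQ.1 hT)
    have h1' := (mem_tangentSpace_iff hP.2).2 h1
    -- Directional derivatives are statements about all curves, so an actual curve is needed before
    -- uniqueness of derivatives can equate the two values.
    obtain ⟨α, hα, hαG, hα0, hα1⟩ := id h1'
    have hαd : HasDerivAt α (ad (ad ξ Q) (riemExp Q ξ)) 0 :=
      hα1 ▸ (hα.differentiable (by simp)).differentiableAt.hasDerivAt
    have h2 := (hgrad.2.2 _ h1' α hαG hα0 hαd).unique (hcrit _ h1' α hαG hα0 hαd)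
    rw [metric_two_smul, metric_self_eq_sqNorm h1.1] at h2
    have h3 := eq_zero_of_sqNorm (by linarith : sqNorm (ad (ad ξ Q) (riemExp Q ξ)) = 0)
    have h4 : Commute (ad ξ Q) (riemExp Q ξ) := sub_eq_zero.1 h3
    have h5 : NormedSpace.exp (-ad ξ Q) * riemExp Q ξ * NormedSpace.exp (ad ξ Q) =
        riemExp Q ξ := by
      rw [(h4.neg_left.exp_left).eq, mul_assoc, exp_neg_mul_exp, mul_one]
    rw [← h5, riemExp, ← mul_assoc, ← mul_assoc, exp_neg_mul_exp, one_mul, mul_assoc,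
      exp_neg_mul_exp, mul_one]
  · intro hPQ H hH
    have h0 : (0 : Mat n) ∈ tangentBall m Q r :=
      (mem_tangentBall_iff hQ).2 ⟨by simp [IsTangent], by simp [metric, he.pos]⟩
    have h1 : riemExp Q 0 = Q := by simp [riemExp, ad]
    have hξ0 : ξ = 0 := (he.bijOn_riemExp hQ).injOn hξ h0 (hPQ.trans h1.symm)
    have h2 := hgrad.2.2 H hH
    rw [hξ0] at h2 ⊢
    simpa [ad, metric] using h2

end LogChart

end Grass
end

theorem mainTheorem2 (m n : ℕ) (Q : Matrix (Fin n) (Fin n) ℂ) (hQ : Q ∈ Grass.Gr m n) :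
    ∃ (r : ℝ) (U : Set (Matrix (Fin n) (Fin n) ℂ)),
      0 < r ∧ IsOpen U ∧ Q ∈ U ∧
      Set.BijOn (Grass.riemExp Q) (Grass.tangentBall m Q r) (U ∩ Grass.Gr m n) ∧
      (∀ ξ ∈ Grass.tangentBall m Q r, ∀ P, P = Grass.riemExp Q ξ →
        (ξ * ξ).trace = ((Grass.dist m P Q ^ 2 : ℝ) : ℂ) ∧
        Grass.IsRiemGrad m (fun X => Grass.dist m X Q ^ 2) P
          ((2 : ℂ) • Grass.ad (Grass.ad ξ Q) P)) ∧
      (∀ P ∈ U ∩ Grass.Gr m n,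
        Grass.IsCriticalPt m (fun X => Grass.dist m X Q ^ 2) P ↔ P = Q) := by
  obtain ⟨e, r, he⟩ := Grass.exists_isLogChart n
  refine ⟨r, Grass.logDomain Q r, he.pos, he.isOpen_logDomain Q, he.mem_logDomain_self hQ,
    he.bijOn_riemExp hQ, ?_, fun P hP => he.isCriticalPt_iff hQ hP⟩
  rintro ξ hξ P rfl
  have hT := ((Grass.mem_tangentBall_iff hQ).1 hξ).1
  refine ⟨?_, he.isRiemGrad hQ hξ⟩
  rw [Grass.dist_riemExp_sq hQ hT (Grass.metric_le_one he hQ hξ),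
    Grass.trace_mul_self_eq_metric hT.1]
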